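/- Conventions. "Increasing" and "decreasing" are meant in the weak sense. For a distribution function $G$ on $\mathbb{R}$ let $G^{-1}(t)=\inf\{y\in\mathbb{R}: G(y)\ge t\}$, $t\in(0,1)$; $F_Y$ is the distribution function of $Y$ and $q_Y=F_Y^{-1}$. Bounded random variables $S,T$ (possibly on different probability spaces) satisfy $S\le_{cx}T$ if $\mathbb{E}\varphi(S)\le\mathbb{E}\varphi(T)$ for all convex $\varphi:\mathbb{R}\to\mathbb{R}$. For real random variables $Y,Y'$ and random vectors $\mathbf{X},\mathbf{X}'$ of possibly different dimensions, write $(Y,\mathbf{X})\preccurlyeq_{ccx}(Y',\mathbf{X}')$ if $P(Y\ge q_Y(v)\mid\mathbf{X})\le_{cx}P(Y'\ge q_{Y'}(v)\mid\mathbf{X}')$ for all $v\in(0,1)$, and $(Y,\mathbf{X})=_{ccx}(Y',\mathbf{X}')$ if both $(Y,\mathbf{X})\preccurlyeq_{ccx}(Y',\mathbf{X}')$ and $(Y',\mathbf{X}')\preccurlyeq_{ccx}(Y,\mathbf{X})$. A bivariate random vector $(W_1,W_2)$ is stochastically increasing (SI) if, for a regular conditional distribution of $W_1$ given $W_2$,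 $\mathbb{E}[f(W_1)\mid W_2=t]$ is increasing in $t$, for $t$ in a set of full $P^{W_2}$-measure that does not depend on $f$, for all increasing $f:\mathbb{R}\to\mathbb{R}$ such that the expectations exist. A decreasing rearrangement of $h:(0,1)^p\to\mathbb{R}$ is a decreasing function $h^*:(0,1)\to\mathbb{R}$ with $\lambda(h^*\ge w)=\lambda^p(h\ge w)$ for all $w\in\mathbb{R}$, where $\lambda^p$ is Lebesgue measure on $(0,1)^p$ and $\lambda=\lambda^1$. The multivariate quantile transform of $\mathbf{X}=(X_1,\dots,X_p)$ is $\mathbf{q}_{\mathbf{X}}(\mathbf{u})=(\zeta_1,\dots,\zeta_p)$, $\mathbf{u}\in(0,1)^p$, where recursively $\zeta_1=F_{X_1}^{-1}(u_1)$ and $\zeta_i=F^{-1}_{X_i\mid X_1=\zeta_1,\dots,X_{i-1}=\zeta_{i-1}}(u_i)$ for $i\geq 2$. Statement. Let $(Y,\mathbf{X})$ be a random vector with values in $\mathbb{R}\times\mathbb{R}^p$. There exist functions $(y,u)\mapsto F_u(y)$, $y\in\mathbb{R}$, $u\in(0,1)$, such that for every $y$ the function $u\mapsto F_u(y)$ is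 a decreasing rearrangement of $\mathbf{u}\mapsto P(Y\le y\mid\mathbf{X}=\mathbf{q}_{\mathbf{X}}(\mathbf{u}))$ and for every $u\in(0,1)$ the function $F_u$ is a distribution function. For every such version let $q^{\uparrow u}_{Y|\mathbf{X}}(t):=F_u^{-1}(t)$ be the rearranged quantile transform. If $U,V$ are independent and uniformly distributed on $(0,1)$ (on any probability space), then (i) $q^{\uparrow U}_{Y|\mathbf{X}}(V)\stackrel{d}{=}Y$; (ii) $(q^{\uparrow U}_{Y|\mathbf{X}}(V),U)$ is a bivariate SI random vector; (iii) $(q^{\uparrow U}_{Y|\mathbf{X}}(V),U)=_{ccx}(Y,\mathbf{X})$. -/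

import Mathlib

open MeasureTheory ProbabilityTheory Set Filter Topology

noncomputable section

namespace CondConvexOrder

/-- `G` is the distribution function of a probability measure on the real line. -/
structure IsDistributionFunction (G : ℝ → ℝ) : Prop where
  mono : Monotone G
  right_continuous : ∀ y, ContinuousWithinAt G (Ici y) y
  tendsto_atBot : Tendsto G atBot (𝓝 0)
  tendsto_atTop : Tendsto G atTop (𝓝 1)

/-- The left-continuous generalized inverse `G⁻¹(t) = inf {y | G y ≥ t}`, meaningful for
`t ∈ (0,1)` when `G` is a distribution function. -/
def genInv (G : ℝ → ℝ) (t : ℝ) : ℝ := sInf {y | t ≤ G y}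

/-- The quantile function `q_Y` of a real random variable `Y` under `P`. -/
def quantile {Ω : Type*} [MeasurableSpace Ω] (P : Measure Ω) (Y : Ω → ℝ) (v : ℝ) : ℝ :=
  genInv (cdf (P.map Y)) v

/-- Convex order `S ≤_cx T` of two bounded random variables, possibly on different probability
spaces. (A convex function on `ℝ` is continuous, so both expectations exist.) -/
def ConvexOrderLE {Ω Ω' : Type*} [MeasurableSpace Ω] [MeasurableSpace Ω']
    (P : Measure Ω) (S : Ω → ℝ) (P' : Measure Ω') (T : Ω' → ℝ) : Prop :=
  ∀ φ : ℝ → ℝ, ConvexOn ℝ univ φ → ∫ ω, φ (S ω) ∂P ≤ ∫ ω, φ (T ω) ∂P'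

/-- The conditional survival probability `P(Y ≥ c ∣ X)`, as a random variable. -/
def condSurvival {Ω E : Type*} [MeasurableSpace Ω] [mE : MeasurableSpace E]
    (P : Measure Ω) (Y : Ω → ℝ) (X : Ω → E) (c : ℝ) : Ω → ℝ :=
  P⟦Y ⁻¹' Ici c | mE.comap X⟧

/-- The conditional convex order `(Y, X) ≼_ccx (Y', X')`. The conditioning variables take values
in arbitrary measurable spaces, so that vectors of different dimensions can be compared. -/
def CcxLE {Ω Ω' E E' : Type*} [MeasurableSpace Ω] [MeasurableSpace Ω']
    [MeasurableSpace E] [MeasurableSpace E']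
    (P : Measure Ω) (Y : Ω → ℝ) (X : Ω → E)
    (P' : Measure Ω') (Y' : Ω' → ℝ) (X' : Ω' → E') : Prop :=
  ∀ v ∈ Ioo (0 : ℝ) 1,
    ConvexOrderLE P (condSurvival P Y X (quantile P Y v))
      P' (condSurvival P' Y' X' (quantile P' Y' v))

/-- Equivalence `(Y, X) =_ccx (Y', X')` with respect to the conditional convex order. -/
def CcxEquiv {Ω Ω' E E' : Type*} [MeasurableSpace Ω] [MeasurableSpace Ω']
    [MeasurableSpace E] [MeasurableSpace E']
    (P : Measure Ω) (Y : Ω → ℝ) (X : Ω → E)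
    (P' : Measure Ω') (Y' : Ω' → ℝ) (X' : Ω' → E') : Prop :=
  CcxLE P Y X P' Y' X' ∧ CcxLE P' Y' X' P Y X

/-- The bivariate random vector `(W₁, W₂)` is stochastically increasing: for every increasing `f`,
`E[f(W₁) ∣ W₂ = t] = ∫ f d(law of W₁ given W₂ = t)` is increasing in `t`, whenever the expectations
exist. As conditional laws are only determined up to null sets of the law of `W₂`, `t` ranges over
a set of full measure, which does not depend on `f`. -/
def IsStochIncreasing {Ω : Type*} [MeasurableSpace Ω] (P : Measure Ω) [IsFiniteMeasure P]
    (W₁ W₂ : Ω → ℝ) : Prop :=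
  AEMeasurable W₁ P ∧ AEMeasurable W₂ P ∧
    ∃ A : Set ℝ, (∀ᵐ t ∂(P.map W₂), t ∈ A) ∧
      ∀ f : ℝ → ℝ, Monotone f → ∀ s ∈ A, ∀ t ∈ A, s ≤ t →
        Integrable f (condDistrib W₁ W₂ P s) → Integrable f (condDistrib W₁ W₂ P t) →
          ∫ y, f y ∂(condDistrib W₁ W₂ P s) ≤ ∫ y, f y ∂(condDistrib W₁ W₂ P t)

/-- The multivariate quantile transform `q_X(u) = (ζ₁, …, ζ_p)`, where `ζᵢ` is the `uᵢ`-quantile of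
the conditional law of `Xᵢ` given `(X₁, …, Xᵢ₋₁) = (ζ₁, …, ζᵢ₋₁)`. (In the first step the
conditioning variable takes its only possible value, so `ζ₁` is the `u₁`-quantile of `X₁`.) -/
def mvQuantile {Ω : Type*} [MeasurableSpace Ω] (P : Measure Ω) [IsFiniteMeasure P] :
    (p : ℕ) → (Ω → Fin p → ℝ) → (Fin p → ℝ) → (Fin p → ℝ)
  | 0, _, u => u
  | p + 1, X, u =>
    let XInit : Ω → Fin p → ℝ := fun ω i => X ω i.castSucc
    let ζ : Fin p → ℝ := mvQuantile P p XInit (fun i => u i.castSucc)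
    Fin.snoc (α := fun _ => ℝ) ζ
      (genInv (cdf (condDistrib (fun ω => X ω (Fin.last p)) XInit P ζ)) (u (Fin.last p)))

/-- `g` is (on `(0,1)`) a decreasing rearrangement of the function `h` on the cube `(0,1)^k`. -/
def IsDecreasingRearrangement {k : ℕ} (h : (Fin k → ℝ) → ℝ) (g : ℝ → ℝ) : Prop :=
  AntitoneOn g (Ioo 0 1) ∧
    ∀ w : ℝ, volume {t : ℝ | t ∈ Ioo (0 : ℝ) 1 ∧ w ≤ g t} =
      volume {u : Fin k → ℝ | (∀ i, u i ∈ Ioo (0 : ℝ) 1) ∧ w ≤ h u}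

/-- `F u y` is a version of the rearranged conditional distribution function: for each `y`, the
function `u ↦ F u y` is a decreasing rearrangement of `u ↦ P(Y ≤ y ∣ X = q_X(u))`, and `F u` is a
distribution function for each `u ∈ (0,1)`. -/
structure IsRearrangedCDF {Ω : Type*} [MeasurableSpace Ω] (P : Measure Ω) [IsFiniteMeasure P]
    {p : ℕ} (Y : Ω → ℝ) (X : Ω → Fin p → ℝ) (F : ℝ → ℝ → ℝ) : Prop where
  rearrangement : ∀ y : ℝ, IsDecreasingRearrangement
    (fun u : Fin p → ℝ => (condDistrib Y X P (mvQuantile P p X u)).real (Iic y))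
    (fun u : ℝ => F u y)
  distribution : ∀ u ∈ Ioo (0 : ℝ) 1, IsDistributionFunction (F u)

/-- The rearranged quantile transform `q_{Y|X}^{↑u}(t) = F_u⁻¹(t)` belonging to a version `F` of
the rearranged conditional distribution function. -/
def rearrangedQuantile (F : ℝ → ℝ → ℝ) (u t : ℝ) : ℝ := genInv (F u) t

end CondConvexOrder

end

open CondConvexOrder

/-! The multivariate quantile transform carries the uniform law on the cube to the law of `X`
(`exists_measurable_mvQuantile`), and a rearrangement keeps the measure of superlevel sets. So for
each `y`, with `U` uniform, `F U y` has the same law as `P(Y ≤ y ∣ X)`. Everything about laws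
follows from this (`IsRearrangedCDF.exists_kernel`): averaging over `U` gives (i), and letting `y ↑
c` identifies the laws of the survival probabilities at every level `c`. Since (i) makes the
quantiles agree, both inequalities in (iii) are equalities.

For (ii), `F u y` decreases in `u`, so its inverse at a fixed `t` increases in `u`: the conditional
laws at `s ≤ t` are coupled monotonically by the same uniform noise.

For existence, take the rearrangement defined by a supremum. The equivalence `le_rearranged_iff`
holds at every `u ≤ 1`, so monotonicity, right continuity and limits in `y` transfer with no
exceptional null set. -/

namespace CondConvexOrder

/-- The uniform distribution on `(0,1)`. -/
noncomputable abbrev unif : Measure ℝ := volume.restrict (Ioo (0 : ℝ) 1)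

instance isProbabilityMeasure_unif : IsProbabilityMeasure (volume.restrict (Ioo (0 : ℝ) 1)) :=
  ⟨by simp⟩

lemma ae_unif_mem : ∀ᵐ t ∂unif, t ∈ Ioo (0 : ℝ) 1 := ae_restrict_mem measurableSet_Ioo

/-! ### Distribution functions and their generalized inverses. -/

namespace IsDistributionFunction

variable {G : ℝ → ℝ}

lemma nonneg (hG : IsDistributionFunction G) (y : ℝ) : 0 ≤ G y :=
  hG.mono.le_of_tendsto hG.tendsto_atBot y

lemma le_one (hG : IsDistributionFunction G) (y : ℝ) : G y ≤ 1 :=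
  hG.mono.ge_of_tendsto hG.tendsto_atTop y

lemma bddBelow_superlevel (hG : IsDistributionFunction G) {t : ℝ} (ht : 0 < t) :
    BddBelow {y | t ≤ G y} := by
  obtain ⟨a, ha⟩ := (hG.tendsto_atBot.eventually_lt_const ht).exists
  exact ⟨a, fun y hy => le_of_not_gt fun h => (ha.trans_le hy).not_ge (hG.mono h.le)⟩

lemma nonempty_superlevel (hG : IsDistributionFunction G) {t : ℝ} (ht : t < 1) :
    {y | t ≤ G y}.Nonempty := by
  obtain ⟨a, ha⟩ := (hG.tendsto_atTop.eventually_const_lt ht).exists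
  exact ⟨a, ha.le⟩

/-- Galois connection between a distribution function and its generalized inverse. -/
lemma genInv_le_iff (hG : IsDistributionFunction G) {t : ℝ} (ht : t ∈ Ioo (0 : ℝ) 1) (y : ℝ) :
    genInv G t ≤ y ↔ t ≤ G y := by
  have hbdd := hG.bddBelow_superlevel ht.1
  refine ⟨fun h => ?_, fun h => csInf_le hbdd h⟩
  -- Right continuity makes the infimum a minimum: otherwise `G < t` just to the right of it as
  -- well.
  suffices t ≤ G (genInv G t) from this.trans (hG.mono h)
  by_contra! hlt
  obtain ⟨b, hb, hsub⟩ := (mem_nhdsGE_iff_exists_Ico_subset).1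
    ((hG.right_continuous (genInv G t)).eventually_lt_const hlt)
  obtain ⟨z, hz, hzb⟩ := exists_lt_of_csInf_lt (hG.nonempty_superlevel ht.2) hb
  exact not_lt_of_ge (show t ≤ G z from hz) (hsub ⟨csInf_le hbdd hz, hzb⟩)

end IsDistributionFunction

lemma isDistributionFunction_cdf (μ : Measure ℝ) : IsDistributionFunction (cdf μ) :=
  ⟨monotone_cdf μ, (cdf μ).right_continuous, tendsto_cdf_atBot μ, tendsto_cdf_atTop μ⟩

/-! ### Inverse transform sampling, with parameters. -/

section Quantile

variable {E : Type*}

/-- The quantile transform of a family of distribution functions, set to `0` off `(0,1)`. -/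
noncomputable def quantileExt (G : E → ℝ → ℝ) (z : E × ℝ) : ℝ := (Ioo (0 : ℝ) 1).indicator (genInv (G z.1)) z.2

lemma quantileExt_of_mem (G : E → ℝ → ℝ) (x : E) {t : ℝ} (ht : t ∈ Ioo (0 : ℝ) 1) :
    quantileExt G (x, t) = genInv (G x) t := indicator_of_mem ht _

variable [MeasurableSpace E] {G : E → ℝ → ℝ}

/-- By `genInv_le_iff` a sublevel set on `(0,1)` is `{t ≤ G x y}`, so joint measurability needs only
measurability in `x` for fixed `y`. Off `(0,1)` the value `0` is harmless. -/
lemma measurable_quantileExt (hG : ∀ x, IsDistributionFunction (G x))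
    (hm : ∀ y, Measurable (G · y)) : Measurable (quantileExt G) := by
  refine measurable_of_Iic fun y => ?_
  have : quantileExt G ⁻¹' Iic y =
      ({z | z.2 ∈ Ioo (0 : ℝ) 1} ∩ {z | z.2 ≤ G z.1 y}) ∪ ({z | z.2 ∈ Ioo (0 : ℝ) 1}ᶜ ∩ {_z | 0 ≤ y}) := by
    ext ⟨x, t⟩
    by_cases ht : t ∈ Ioo (0 : ℝ) 1
    · simp only [mem_preimage, quantileExt_of_mem G x ht, mem_Iic, (hG x).genInv_le_iff ht]
      simp [ht.1, ht.2]
    · simp only [mem_preimage, quantileExt, indicator_of_notMem ht, mem_Iic]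
      simp only [mem_union, mem_inter_iff, mem_ofPred_eq, mem_compl_iff, ht]
      simp
  rw [this]
  have h1 : MeasurableSet {z : E × ℝ | z.2 ∈ Ioo (0 : ℝ) 1} := measurable_snd measurableSet_Ioo
  exact (h1.inter (measurableSet_le measurable_snd ((hm y).comp measurable_fst))).union
    (h1.compl.inter (MeasurableSet.const _))

lemma unif_Iic {a : ℝ} (h0 : 0 ≤ a) (h1 : a ≤ 1) : unif (Iic a) = ENNReal.ofReal a := by
  rw [Measure.restrict_apply measurableSet_Iic, inter_comm]
  rcases h1.lt_or_eq with h | rfl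
  · rw [show Ioo (0 : ℝ) 1 ∩ Iic a = Ioc 0 a by
      ext t; simp only [mem_inter_iff, mem_Ioo, mem_Iic, mem_Ioc]; grind]
    simp
  · rw [show Ioo (0 : ℝ) 1 ∩ Iic 1 = Ioo 0 1 by
      ext t; simp only [mem_inter_iff, mem_Ioo, mem_Iic]; grind]
    simp

lemma map_quantileExt_Iic (hG : ∀ x, IsDistributionFunction (G x))
    (hm : ∀ y, Measurable (G · y)) (x : E) (y : ℝ) :
    unif.map (fun t => quantileExt G (x, t)) (Iic y) = ENNReal.ofReal (G x y) := by
  have hq : Measurable fun t => quantileExt G (x, t) :=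
    (measurable_quantileExt hG hm).comp measurable_prodMk_left
  rw [Measure.map_apply hq measurableSet_Iic, ← unif_Iic ((hG x).nonneg y) ((hG x).le_one y)]
  refine measure_congr ?_
  filter_upwards [ae_unif_mem] with t ht
  exact propext (show quantileExt G (x, t) ≤ y ↔ t ≤ G x y by
    rw [quantileExt_of_mem G x ht, (hG x).genInv_le_iff ht])

lemma map_quantileExt_eq (hG : ∀ x, IsDistributionFunction (G x))
    (hm : ∀ y, Measurable (G · y)) (x : E) (μ : Measure ℝ) [IsFiniteMeasure μ]
    (h : ∀ y, μ (Iic y) = ENNReal.ofReal (G x y)) :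
    unif.map (fun t => quantileExt G (x, t)) = μ :=
  (Measure.ext_of_Iic _ _ fun y => by rw [h, map_quantileExt_Iic hG hm]).symm

/-- Sampling from a kernel by applying a map to independent uniform noise. -/
lemma map_prod_unif_eq_compProd (ν : Measure E) [IsProbabilityMeasure ν] (K : Kernel E ℝ)
    [IsMarkovKernel K] {q : E × ℝ → ℝ} (hq : Measurable q)
    (hK : ∀ x, unif.map (fun t => q (x, t)) = K x) :
    (ν.prod unif).map (fun z => (z.1, q z)) = ν ⊗ₘ K := by
  ext s hs
  have hm : Measurable fun z : E × ℝ => (z.1, q z) := measurable_fst.prodMk hq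
  rw [Measure.map_apply hm hs, Measure.prod_apply (hm hs), Measure.compProd_apply hs]
  refine lintegral_congr fun x => ?_
  rw [← hK x, Measure.map_apply (by fun_prop) (measurable_prodMk_left hs)]
  rfl

/-- Realizing the laws as images of uniform noise under one jointly measurable map gives
measurability in `x` for free. -/
lemma exists_kernel_of_isDistributionFunction (hG : ∀ x, IsDistributionFunction (G x))
    (hm : ∀ y, Measurable (G · y)) :
    ∃ K : Kernel E ℝ, IsMarkovKernel K ∧ (∀ x, unif.map (fun t => quantileExt G (x, t)) = K x) ∧
      ∀ x y, (K x).real (Iic y) = G x y := by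
  have hq := measurable_quantileExt hG hm
  have hK : ∀ x, unif.map (fun t => quantileExt G (x, t)) =
      Kernel.map (Kernel.id ×ₖ Kernel.const E unif) (quantileExt G) x := fun x => by
    rw [Kernel.map_apply _ hq, Kernel.prod_apply, Kernel.id_apply, Kernel.const_apply,
      Measure.dirac_prod, Measure.map_map hq measurable_prodMk_left]
    rfl
  refine ⟨_, Kernel.IsMarkovKernel.map _ hq, hK, fun x y => ?_⟩
  rw [measureReal_def, ← hK, map_quantileExt_Iic hG hm, ENNReal.toReal_ofReal ((hG x).nonneg y)]

lemma map_quantileExt_cdf (K : Kernel E ℝ) [IsMarkovKernel K] :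
    Measurable (quantileExt fun x => cdf (K x)) ∧
      ∀ x, unif.map (fun t => quantileExt (fun x => cdf (K x)) (x, t)) = K x := by
  have hG := fun x => isDistributionFunction_cdf (K x)
  have hm : ∀ y, Measurable fun x => cdf (K x) y := fun y => by
    simp only [cdf_eq_real, measureReal_def]
    exact (K.measurable_coe measurableSet_Iic).ennreal_toReal
  exact ⟨measurable_quantileExt hG hm, fun x =>
    map_quantileExt_eq hG hm x (K x) fun y => (ofReal_cdf (K x) y).symm⟩

end Quantile

/-! ### The multivariate quantile transform of uniform noise. -/

section MvQuantile

/-- The uniform distribution on the cube `(0,1)^p`. -/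
noncomputable abbrev unifCube (p : ℕ) : Measure (Fin p → ℝ) := Measure.pi fun _ => unif

lemma measurable_snoc (p : ℕ) :
    Measurable fun z : (Fin p → ℝ) × ℝ => (Fin.snoc (α := fun _ => ℝ) z.1 z.2 : Fin (p + 1) → ℝ) := by
  refine measurable_pi_iff.2 fun i => ?_
  induction i using Fin.lastCases with
  | last => simpa using measurable_snd
  | cast i => simpa using! (measurable_pi_apply i).comp measurable_fst

lemma map_snoc_unifCube (p : ℕ) :
    ((unifCube p).prod unif).map
      (fun z => (Fin.snoc (α := fun _ => ℝ) z.1 z.2 : Fin (p + 1) → ℝ)) = unifCube (p + 1) := by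
  refine (Measure.pi_eq fun s hs => ?_).symm
  rw [Measure.map_apply (measurable_snoc p) (MeasurableSet.univ_pi hs)]
  have : (fun z : (Fin p → ℝ) × ℝ => (Fin.snoc (α := fun _ => ℝ) z.1 z.2 : Fin (p + 1) → ℝ)) ⁻¹'
      univ.pi s = (univ.pi fun i : Fin p => s i.castSucc) ×ˢ s (Fin.last p) := by
    ext z
    simp [Fin.forall_fin_succ']
  rw [this, Measure.prod_prod, Measure.pi_pi, Fin.prod_univ_castSucc]

/-- The multivariate quantile transform maps the uniform distribution on the cube to the law
of `X`. -/
lemma exists_measurable_mvQuantile {Ω : Type*} [MeasurableSpace Ω] (P : Measure Ω)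
    [IsProbabilityMeasure P] (p : ℕ) (X : Ω → Fin p → ℝ) (hX : Measurable X) :
    ∃ Q : (Fin p → ℝ) → (Fin p → ℝ), Measurable Q ∧
      (∀ u, (∀ i, u i ∈ Ioo (0 : ℝ) 1) → mvQuantile P p X u = Q u) ∧
      (unifCube p).map Q = P.map X := by
  induction p with
  | zero =>
    refine ⟨id, measurable_id, fun u _ => rfl, ?_⟩
    have := Measure.isProbabilityMeasure_map (μ := P) hX.aemeasurable
    rw [Measure.map_id]
    ext s -
    rcases s.eq_empty_or_nonempty with rfl | hs
    · simp
    · rw [Subsingleton.eq_univ_of_nonempty hs, measure_univ, measure_univ]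
  | succ p ih =>
    have hXi : Measurable fun ω (i : Fin p) => X ω i.castSucc := by fun_prop
    obtain ⟨Q, hQ, hQeq, hQmap⟩ := ih (fun ω i => X ω i.castSucc) hXi
    set κ := condDistrib (fun ω => X ω (Fin.last p)) (fun ω (i : Fin p) => X ω i.castSucc) P with hκ
    obtain ⟨hq, hqmap⟩ := map_quantileExt_cdf κ
    set q := quantileExt fun x => cdf (κ x) with hq_def
    have hpair : Measurable fun z : (Fin p → ℝ) × ℝ => (z.1, q z) := measurable_fst.prodMk hq
    have hid : Measurable (Prod.map Q (id : ℝ → ℝ)) := hQ.prodMap measurable_id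
    have hsplit : Measurable fun u : Fin (p + 1) → ℝ => (fun i : Fin p => u i.castSucc, u (Fin.last p)) := by
      fun_prop
    have hall := (measurable_snoc p).comp (hpair.comp hid)
    refine ⟨_, hall.comp hsplit, fun u hu => ?_, ?_⟩
    · simp only [mvQuantile, Function.comp_apply, Prod.map, id]
      rw [hQeq _ fun i => hu i.castSucc, hq_def, quantileExt_of_mem _ _ (hu (Fin.last p))]
    · have := Measure.isProbabilityMeasure_map (μ := P) hXi.aemeasurable
      -- Splitting cancels `Fin.snoc`; `Q` turns the initial coordinates into the law of the initial
      -- part of `X`, and `q` turns the last uniform into `κ`. Disintegration recovers the joint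
      -- law.
      rw [← map_snoc_unifCube, Measure.map_map (hall.comp hsplit) (measurable_snoc p),
        Function.comp_assoc _ _ (fun z : (Fin p → ℝ) × ℝ => (Fin.snoc _ _ : Fin (p + 1) → ℝ)),
        show (fun u : Fin (p + 1) → ℝ => (fun i : Fin p => u i.castSucc, u (Fin.last p))) ∘
          (fun z : (Fin p → ℝ) × ℝ => (Fin.snoc (α := fun _ => ℝ) z.1 z.2 : Fin (p + 1) → ℝ)) = id by
            funext z; simp,
        Function.comp_id,
        ← Measure.map_map (measurable_snoc p) (hpair.comp hid), ← Measure.map_map hpair hid,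
        ← Measure.map_prod_map _ _ hQ measurable_id, hQmap, Measure.map_id,
        map_prod_unif_eq_compProd _ κ hq hqmap, hκ,
        compProd_map_condDistrib (by fun_prop), Measure.map_map (measurable_snoc p) (by fun_prop)]
      congr 1
      funext ω
      refine funext fun i => ?_
      induction i using Fin.lastCases <;> simp

end MvQuantile

/-! ### Existence of a rearrangement consisting of distribution functions. -/

section Rearrangement

variable {E : Type*} [MeasurableSpace E]

/-- The rearranged value at `u`: the largest `w ∈ [0,1]` whose superlevel set `{w ≤ H · y}` has
mass at least `u`. -/
noncomputable def rearranged (ν : Measure E) (H : E → ℝ → ℝ) (u y : ℝ) : ℝ :=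
  sSup {w | w ∈ Icc (0 : ℝ) 1 ∧ u ≤ ν.real {x | w ≤ H x y}}

variable {ν : Measure E} {H : E → ℝ → ℝ} {u y w : ℝ}

lemma bddAbove_levels : BddAbove {w | w ∈ Icc (0 : ℝ) 1 ∧ u ≤ ν.real {x | w ≤ H x y}} :=
  ⟨1, fun _ h => h.1.2⟩

variable [IsProbabilityMeasure ν]

lemma zero_mem_levels (hH : ∀ x, IsDistributionFunction (H x)) (hu : u ≤ 1) :
    (0 : ℝ) ∈ {w | w ∈ Icc (0 : ℝ) 1 ∧ u ≤ ν.real {x | w ≤ H x y}} := by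
  refine ⟨by simp, ?_⟩
  simpa [(hH _).nonneg y] using hu

lemma rearranged_nonneg (hH : ∀ x, IsDistributionFunction (H x)) (hu : u ≤ 1) :
    0 ≤ rearranged ν H u y :=
  le_csSup bddAbove_levels (zero_mem_levels hH hu)

lemma rearranged_le_one (hH : ∀ x, IsDistributionFunction (H x)) (hu : u ≤ 1) :
    rearranged ν H u y ≤ 1 :=
  csSup_le ⟨0, zero_mem_levels hH hu⟩ fun _ h => h.1.2

/-- The supremum is attained because `w ↦ ν {w ≤ H · y}` is left continuous, by continuity from
above along `a n ↑ w`. -/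
lemma le_rearranged_iff (hH : ∀ x, IsDistributionFunction (H x)) (hm : ∀ y, Measurable (H · y))
    (hu : u ≤ 1) (hw : w ∈ Icc (0 : ℝ) 1) :
    w ≤ rearranged ν H u y ↔ u ≤ ν.real {x | w ≤ H x y} := by
  refine ⟨fun h => ?_, fun h => le_csSup bddAbove_levels ⟨hw, h⟩⟩
  obtain ⟨a, ha, haw, hlim⟩ := exists_seq_strictMono_tendsto w
  have hge : ∀ n, u ≤ ν.real {x | a n ≤ H x y} := fun n => by
    obtain ⟨b, hb, hab⟩ := exists_lt_of_lt_csSup ⟨0, zero_mem_levels hH hu⟩ ((haw n).trans_le h)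
    exact hb.2.trans (measureReal_mono fun x (hx : b ≤ H x y) => hab.le.trans hx)
  have hset : {x | w ≤ H x y} = ⋂ n, {x | a n ≤ H x y} := by
    ext x
    simp only [mem_ofPred_eq, mem_iInter]
    exact ⟨fun hx n => (haw n).le.trans hx, fun hx => le_of_tendsto' hlim hx⟩
  have htend := tendsto_measure_iInter_atTop (μ := ν) (s := fun n => {x | a n ≤ H x y})
    (fun n => (measurableSet_le measurable_const (hm y)).nullMeasurableSet)
    (fun i j hij x (hx : a j ≤ H x y) => (ha.monotone hij).trans hx) ⟨0, measure_ne_top _ _⟩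
  rw [← hset] at htend
  exact ge_of_tendsto' ((ENNReal.tendsto_toReal (measure_ne_top _ _)).comp htend) hge

lemma rearranged_lt_iff (hH : ∀ x, IsDistributionFunction (H x)) (hm : ∀ y, Measurable (H · y))
    (hu : u ≤ 1) (hw : w ∈ Icc (0 : ℝ) 1) :
    rearranged ν H u y < w ↔ ν.real {x | w ≤ H x y} < u := by
  rw [← not_le, le_rearranged_iff hH hm hu hw, not_le]

lemma monotone_rearranged (hH : ∀ x, IsDistributionFunction (H x)) (hu : u ≤ 1) :
    Monotone (rearranged ν H u) := fun _ _ h =>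
  csSup_le_csSup bddAbove_levels ⟨0, zero_mem_levels hH hu⟩ fun _ hw =>
    ⟨hw.1, hw.2.trans (measureReal_mono fun x hx => le_trans hx ((hH x).mono h))⟩

lemma antitoneOn_rearranged (hH : ∀ x, IsDistributionFunction (H x)) (y : ℝ) :
    AntitoneOn (fun u => rearranged ν H u y) (Iic 1) := fun _ _ _ hu h =>
  csSup_le_csSup bddAbove_levels ⟨0, zero_mem_levels hH hu⟩ fun _ hw => ⟨hw.1, h.trans hw.2⟩

lemma volume_le_rearranged (hH : ∀ x, IsDistributionFunction (H x))
    (hm : ∀ y, Measurable (H · y)) (y w : ℝ) :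
    volume {t : ℝ | t ∈ Ioo (0 : ℝ) 1 ∧ w ≤ rearranged ν H t y} = ν {x | w ≤ H x y} := by
  rcases le_or_gt w 0 with h0 | h0
  · rw [show {t : ℝ | t ∈ Ioo (0 : ℝ) 1 ∧ w ≤ rearranged ν H t y} = Ioo 0 1 from
        Subset.antisymm (fun t ht => ht.1)
          fun t ht => ⟨ht, h0.trans (rearranged_nonneg hH ht.2.le)⟩,
      show {x | w ≤ H x y} = univ from
        eq_univ_of_forall fun x => h0.trans ((hH x).nonneg y)]
    simp
  rcases lt_or_ge 1 w with h1 | h1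
  · rw [show {t : ℝ | t ∈ Ioo (0 : ℝ) 1 ∧ w ≤ rearranged ν H t y} = ∅ from
        eq_empty_of_forall_notMem fun t ht =>
          (ht.2.trans (rearranged_le_one hH ht.1.2.le)).not_gt h1,
      show {x | w ≤ H x y} = ∅ from
        eq_empty_of_forall_notMem fun x hx => (le_trans hx ((hH x).le_one y)).not_gt h1]
    simp
  · have hset : {t : ℝ | t ∈ Ioo (0 : ℝ) 1 ∧ w ≤ rearranged ν H t y} =
        Iic (ν.real {x | w ≤ H x y}) ∩ Ioo 0 1 := by
      ext t
      exact ⟨fun ht => ⟨(le_rearranged_iff hH hm ht.1.2.le ⟨h0.le, h1⟩).1 ht.2, ht.1⟩,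
        fun ht => ⟨ht.2, (le_rearranged_iff hH hm ht.2.2.le ⟨h0.le, h1⟩).2 ht.1⟩⟩
    rw [hset, ← Measure.restrict_apply measurableSet_Iic,
      unif_Iic measureReal_nonneg measureReal_le_one, ofReal_measureReal]

/-- `le_rearranged_iff` turns each limit in `y` into continuity of `ν` along monotone superlevel
sets. The limit at `-∞` uses `0 < u`, the one at `+∞` uses `u < 1`. -/
lemma isDistributionFunction_rearranged (hH : ∀ x, IsDistributionFunction (H x))
    (hm : ∀ y, Measurable (H · y)) (hu : u ∈ Ioo (0 : ℝ) 1) :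
    IsDistributionFunction (rearranged ν H u) := by
  have hu1 := hu.2.le
  have hmono := monotone_rearranged (ν := ν) hH hu1
  have hnull : ∀ w y, NullMeasurableSet {x | w ≤ H x y} ν := fun w y =>
    (measurableSet_le measurable_const (hm y)).nullMeasurableSet
  refine ⟨hmono, fun y => ?_, ?_, ?_⟩
  · refine tendsto_order.2 ⟨fun a ha => ?_, fun b hb => ?_⟩
    · filter_upwards [self_mem_nhdsWithin] with z hz using ha.trans_le (hmono hz)
    rcases lt_or_ge 1 b with h1 | h1
    · exact Eventually.of_forall fun z => (rearranged_le_one hH hu1).trans_lt h1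
    have hbI : b ∈ Icc (0 : ℝ) 1 := ⟨(rearranged_nonneg hH hu1).trans hb.le, h1⟩
    obtain ⟨a, ha, hya, hlim⟩ := exists_seq_strictAnti_tendsto y
    have hset : {x | b ≤ H x y} = ⋂ n, {x | b ≤ H x (a n)} := by
      ext x
      simp only [mem_ofPred_eq, mem_iInter]
      refine ⟨fun hx n => hx.trans ((hH x).mono (hya n).le), fun hx => ?_⟩
      exact ge_of_tendsto' (((hH x).right_continuous y).tendsto.comp
        (tendsto_nhdsWithin_iff.2 ⟨hlim, Eventually.of_forall fun n => (hya n).le⟩)) hx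
    have htend := tendsto_measure_iInter_atTop (μ := ν) (s := fun n => {x | b ≤ H x (a n)})
      (fun n => hnull _ _)
      (fun i j hij x (hx : b ≤ H x (a j)) => hx.trans ((hH x).mono (ha.antitone hij)))
      ⟨0, measure_ne_top _ _⟩
    rw [← hset] at htend
    obtain ⟨n, hn⟩ := (((ENNReal.tendsto_toReal (measure_ne_top _ _)).comp htend).eventually_lt_const
      ((rearranged_lt_iff hH hm hu1 hbI).1 hb)).exists
    filter_upwards [mem_nhdsWithin_of_mem_nhds (Iio_mem_nhds (hya n))] with z hz
    exact (hmono (le_of_lt hz)).trans_lt ((rearranged_lt_iff hH hm hu1 hbI).2 hn)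
  · refine tendsto_order.2 ⟨fun a ha => Eventually.of_forall fun z =>
      ha.trans_le (rearranged_nonneg hH hu1), fun b hb => ?_⟩
    rcases lt_or_ge 1 b with h1 | h1
    · exact Eventually.of_forall fun z => (rearranged_le_one hH hu1).trans_lt h1
    have hset : ⋂ n : ℕ, {x | b ≤ H x (-(n : ℝ))} = ∅ := by
      refine eq_empty_of_forall_notMem fun x hx => ?_
      exact (ge_of_tendsto' ((hH x).tendsto_atBot.comp
        (tendsto_neg_atTop_atBot.comp tendsto_natCast_atTop_atTop)) (mem_iInter.1 hx)).not_gt hb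
    have htend := tendsto_measure_iInter_atTop (μ := ν) (s := fun n : ℕ => {x | b ≤ H x (-(n : ℝ))})
      (fun n => hnull _ _)
      (fun i j hij x (hx : b ≤ H x (-(j : ℝ))) =>
        hx.trans ((hH x).mono (neg_le_neg (Nat.cast_le.2 hij))))
      ⟨0, measure_ne_top _ _⟩
    rw [hset, measure_empty] at htend
    obtain ⟨n, hn⟩ := (((ENNReal.tendsto_toReal ENNReal.zero_ne_top).comp htend).eventually_lt_const
      (show (0 : ENNReal).toReal < u by simpa using hu.1)).exists
    filter_upwards [Iic_mem_atBot (-(n : ℝ))] with z hz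
    exact (hmono hz).trans_lt ((rearranged_lt_iff hH hm hu1 ⟨hb.le, h1⟩).2 hn)
  · refine tendsto_order.2 ⟨fun a ha => ?_, fun b hb => Eventually.of_forall fun z =>
      (rearranged_le_one hH hu1).trans_lt hb⟩
    -- The maximum with `0` keeps `w` in the range of `le_rearranged_iff`; `w < 1` lets every `H x`
    -- exceed it eventually.
    obtain ⟨w, hw, hw1⟩ := exists_between (max_lt ha one_pos)
    have hset : ⋃ n : ℕ, {x | w ≤ H x (n : ℝ)} = univ := by
      refine eq_univ_of_forall fun x => mem_iUnion.2 ?_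
      obtain ⟨n, hn⟩ := (((hH x).tendsto_atTop.comp
        tendsto_natCast_atTop_atTop).eventually_const_lt hw1).exists (α := ℕ)
      exact ⟨n, hn.le⟩
    have htend := tendsto_measure_iUnion_atTop (μ := ν) (s := fun n : ℕ => {x | w ≤ H x (n : ℝ)})
      (fun i j hij x (hx : w ≤ H x (i : ℝ)) => hx.trans ((hH x).mono (Nat.cast_le.2 hij)))
    rw [hset, measure_univ] at htend
    obtain ⟨n, hn⟩ := (((ENNReal.tendsto_toReal ENNReal.one_ne_top).comp htend).eventually_const_lt
      (show u < (1 : ENNReal).toReal by simpa using hu.2)).exists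
    filter_upwards [Ici_mem_atTop (n : ℝ)] with z hz
    exact ((le_max_left _ _).trans_lt hw).trans_le
      (((le_rearranged_iff hH hm hu1 ⟨(le_max_right _ _).trans hw.le, hw1.le⟩).2 hn.le).trans
        (hmono hz))

end Rearrangement

/-! ### What the laws of the conditional distribution functions determine. -/

section Kernels

variable {E E' : Type*} [MeasurableSpace E] [MeasurableSpace E'] {ν : Measure E} {ν' : Measure E'}
  {κ : Kernel E ℝ} {κ' : Kernel E' ℝ}

lemma measurable_kernel_real (κ : Kernel E ℝ) {s : Set ℝ} (hs : MeasurableSet s) :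
    Measurable fun x => (κ x).real s :=
  (κ.measurable_coe hs).ennreal_toReal

/-- The mixture gives `Iic y` the mean of `(κ x).real (Iic y)`, which depends only on the law of
that variable. -/
lemma comp_eq_of_map_Iic_eq [IsFiniteMeasure ν] [IsMarkovKernel κ] [IsMarkovKernel κ']
    (h : ∀ y, ν.map (fun x => (κ x).real (Iic y)) = ν'.map fun x => (κ' x).real (Iic y)) :
    κ ∘ₘ ν = κ' ∘ₘ ν' := by
  refine Measure.ext_of_Iic _ _ fun y => ?_
  rw [Measure.bind_apply measurableSet_Iic κ.aemeasurable,
    Measure.bind_apply measurableSet_Iic κ'.aemeasurable]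
  have h1 : ∫⁻ r, ENNReal.ofReal r ∂ν.map (fun x => (κ x).real (Iic y)) =
      ∫⁻ r, ENNReal.ofReal r ∂ν'.map (fun x => (κ' x).real (Iic y)) := by rw [h]
  rw [lintegral_map ENNReal.measurable_ofReal (measurable_kernel_real κ measurableSet_Iic),
    lintegral_map ENNReal.measurable_ofReal (measurable_kernel_real κ' measurableSet_Iic)] at h1
  simpa using h1

/-- Bridges from `Y ≤ y` to `Y ≥ c`: `Iic (a n)` increases to `Iio c`, and `φ`, bounded on `[0,1]`,
permits dominated convergence. -/
lemma tendsto_integral_comp_survival (ν : Measure E) [IsFiniteMeasure ν] (κ : Kernel E ℝ)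
    [IsMarkovKernel κ] {φ : ℝ → ℝ} (hφ : Continuous φ) {a : ℕ → ℝ} {c : ℝ} (ha : StrictMono a)
    (hac : ∀ n, a n < c) (hlim : Tendsto a atTop (𝓝 c)) :
    Tendsto (fun n => ∫ x, φ (1 - (κ x).real (Iic (a n))) ∂ν) atTop
      (𝓝 (∫ x, φ ((κ x).real (Ici c)) ∂ν)) := by
  obtain ⟨C, hC⟩ := isCompact_Icc.exists_bound_of_continuousOn (s := Icc (0 : ℝ) 1) hφ.continuousOn
  refine tendsto_integral_of_dominated_convergence (fun _ => C)
    (fun n => (hφ.measurable.comp (measurable_const.sub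
      (measurable_kernel_real κ measurableSet_Iic))).aestronglyMeasurable)
    (integrable_const _) (fun n => Eventually.of_forall fun x => hC _ ?_)
    (Eventually.of_forall fun x => (hφ.tendsto _).comp ?_)
  · exact ⟨sub_nonneg.2 measureReal_le_one, sub_le_self _ measureReal_nonneg⟩
  · have hset : ⋃ n, Iic (a n) = Iio c := by
      ext t
      simp only [mem_iUnion, mem_Iic, mem_Iio]
      refine ⟨fun ⟨n, hn⟩ => hn.trans_lt (hac n), fun ht => ?_⟩
      obtain ⟨n, hn⟩ := (hlim.eventually_const_lt ht).exists
      exact ⟨n, hn.le⟩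
    have htend := tendsto_measure_iUnion_atTop (μ := κ x) (s := fun n => Iic (a n))
      (fun i j hij => Iic_subset_Iic.2 (ha.monotone hij))
    rw [hset] at htend
    rw [← compl_Iio, probReal_compl_eq_one_sub measurableSet_Iio]
    exact ((ENNReal.tendsto_toReal (measure_ne_top _ _)).comp htend).const_sub 1

/-- If all one-dimensional laws of the conditional distribution functions agree, then so do those
of the conditional survival probabilities. -/
lemma integral_comp_survival_eq [IsFiniteMeasure ν] [IsFiniteMeasure ν'] [IsMarkovKernel κ]
    [IsMarkovKernel κ']
    (h : ∀ y, ν.map (fun x => (κ x).real (Iic y)) = ν'.map fun x => (κ' x).real (Iic y))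
    {φ : ℝ → ℝ} (hφ : Continuous φ) (c : ℝ) :
    ∫ x, φ ((κ x).real (Ici c)) ∂ν = ∫ x, φ ((κ' x).real (Ici c)) ∂ν' := by
  obtain ⟨a, ha, hac, hlim⟩ := exists_seq_strictMono_tendsto c
  refine tendsto_nhds_unique (tendsto_integral_comp_survival ν κ hφ ha hac hlim)
    ((tendsto_integral_comp_survival ν' κ' hφ ha hac hlim).congr fun n => ?_)
  have h1 : ∫ r, φ (1 - r) ∂ν.map (fun x => (κ x).real (Iic (a n))) =
      ∫ r, φ (1 - r) ∂ν'.map (fun x => (κ' x).real (Iic (a n))) := by rw [h]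
  have hc : Continuous fun r => φ (1 - r) := by fun_prop
  rw [integral_map (measurable_kernel_real κ measurableSet_Iic).aemeasurable
      hc.aestronglyMeasurable,
    integral_map (measurable_kernel_real κ' measurableSet_Iic).aemeasurable
      hc.aestronglyMeasurable] at h1
  exact h1.symm

end Kernels

/-! ### Kernels attached to a rearranged version, and conditional survival probabilities. -/

section Coupling

variable {Ω : Type*} [MeasurableSpace Ω] {P : Measure Ω}

lemma condSurvival_congr_ae {E : Type*} [MeasurableSpace E] {Y Y' : Ω → ℝ} (X : Ω → E)
    (h : Y =ᵐ[P] Y') (c : ℝ) : condSurvival P Y X c =ᵐ[P] condSurvival P Y' X c := by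
  refine condExp_congr_ae ?_
  filter_upwards [h] with ω hω
  simp only [indicator, mem_preimage, hω]

variable [IsProbabilityMeasure P]

lemma measure_setOf_forall_mem_Ioo {p : ℕ} (s : Set (Fin p → ℝ)) :
    volume {u : Fin p → ℝ | (∀ i, u i ∈ Ioo (0 : ℝ) 1) ∧ u ∈ s} = unifCube p s := by
  rw [unifCube, ← Measure.restrict_pi_pi, ← volume_pi,
    Measure.restrict_apply' (MeasurableSet.univ_pi fun _ => measurableSet_Ioo)]
  congr 1
  ext u
  simp [and_comm]

/-- The distribution of `P(Y ≤ y ∣ X = q_X(u))` on the cube is that of `P(Y ≤ y ∣ X)`. -/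
lemma volume_condDistrib_mvQuantile {p : ℕ} (Y : Ω → ℝ) {X : Ω → Fin p → ℝ}
    (hX : Measurable X) (y w : ℝ) :
    volume {u : Fin p → ℝ | (∀ i, u i ∈ Ioo (0 : ℝ) 1) ∧
      w ≤ (condDistrib Y X P (mvQuantile P p X u)).real (Iic y)} =
      P.map X {x | w ≤ (condDistrib Y X P x).real (Iic y)} := by
  obtain ⟨Q, hQ, hQeq, hQmap⟩ := exists_measurable_mvQuantile P p X hX
  have hs : MeasurableSet {x | w ≤ (condDistrib Y X P x).real (Iic y)} :=
    measurableSet_le measurable_const (measurable_kernel_real _ measurableSet_Iic)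
  rw [← hQmap, Measure.map_apply hQ hs, ← measure_setOf_forall_mem_Ioo]
  congr 1
  ext u
  exact and_congr_right fun hu => by rw [hQeq u hu]; rfl

lemma isDistributionFunction_real_Iic (μ : Measure ℝ) [IsProbabilityMeasure μ] :
    IsDistributionFunction fun y => μ.real (Iic y) := by
  rw [show (fun y => μ.real (Iic y)) = cdf μ from funext fun y => (cdf_eq_real μ y).symm]
  exact isDistributionFunction_cdf μ

lemma exists_isRearrangedCDF {p : ℕ} (Y : Ω → ℝ) {X : Ω → Fin p → ℝ} (hX : Measurable X) :
    ∃ F : ℝ → ℝ → ℝ, IsRearrangedCDF P Y X F := by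
  have := Measure.isProbabilityMeasure_map (μ := P) hX.aemeasurable
  set H : (Fin p → ℝ) → ℝ → ℝ := fun x y => (condDistrib Y X P x).real (Iic y)
  have hH : ∀ x, IsDistributionFunction (H x) := fun x => isDistributionFunction_real_Iic _
  have hm : ∀ y, Measurable (H · y) := fun y => measurable_kernel_real _ measurableSet_Iic
  refine ⟨rearranged (P.map X) H, fun y => ⟨?_, fun w => ?_⟩, fun u hu =>
    isDistributionFunction_rearranged hH hm hu⟩
  · exact (antitoneOn_rearranged hH y).mono fun t ht => ht.2.le
  · rw [volume_condDistrib_mvQuantile Y hX, volume_le_rearranged hH hm]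

/-- Superlevel sets of a decreasing function within an interval are order-connected, hence
measurable. -/
lemma measurable_ite_mem_Ioo_of_antitoneOn {g : ℝ → ℝ} (hg : AntitoneOn g (Ioo 0 1)) (c : ℝ)
    [∀ u : ℝ, Decidable (u ∈ Ioo (0 : ℝ) 1)] :
    Measurable fun u => if u ∈ Ioo (0 : ℝ) 1 then g u else c := by
  refine measurable_of_Ici fun w => ?_
  have hset : (fun u => if u ∈ Ioo (0 : ℝ) 1 then g u else c) ⁻¹' Ici w =
      {u | u ∈ Ioo (0 : ℝ) 1 ∧ w ≤ g u} ∪ ((Ioo (0 : ℝ) 1)ᶜ ∩ {_u | w ≤ c}) := by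
    ext u
    by_cases hu : u ∈ Ioo (0 : ℝ) 1 <;>
    · simp only [mem_preimage, mem_Ici, mem_union, mem_ofPred_eq, hu, mem_inter_iff, mem_compl_iff]
      simp
  rw [hset]
  refine MeasurableSet.union (OrdConnected.measurableSet ⟨fun a ha b hb t ht => ?_⟩)
    (measurableSet_Ioo.compl.inter (MeasurableSet.const _))
  have htI : t ∈ Ioo (0 : ℝ) 1 := ⟨ha.1.1.trans_le ht.1, ht.2.trans_lt hb.1.2⟩
  exact ⟨htI, hb.2.trans (hg htI hb.1 ht.2)⟩

/-- The conditional laws with distribution functions `F u`: they are generated by the quantile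
transform, and their distribution functions have the same law as those of `Y` given `X`. -/
lemma IsRearrangedCDF.exists_kernel {p : ℕ} {Y : Ω → ℝ} {X : Ω → Fin p → ℝ} (hX : Measurable X)
    {F : ℝ → ℝ → ℝ} (hF : IsRearrangedCDF P Y X F) :
    ∃ (K : Kernel ℝ ℝ) (q : ℝ × ℝ → ℝ), IsMarkovKernel K ∧ Measurable q ∧
      (∀ u ∈ Ioo (0 : ℝ) 1, ∀ t ∈ Ioo (0 : ℝ) 1, q (u, t) = rearrangedQuantile F u t) ∧
      (∀ u, unif.map (fun t => q (u, t)) = K u) ∧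
      ∀ y, unif.map (fun u => (K u).real (Iic y)) =
        (P.map X).map fun x => (condDistrib Y X P x).real (Iic y) := by
  classical
  -- `F u` is unconstrained off `(0,1)`; the choice `F (1 / 2)` makes every `G u` a distribution
  -- function and changes nothing `unif`-a.e.
  set G : ℝ → ℝ → ℝ := fun u => if u ∈ Ioo (0 : ℝ) 1 then F u else F (1 / 2) with hG_def
  have hGF : ∀ u ∈ Ioo (0 : ℝ) 1, G u = F u := fun u hu => if_pos hu
  have hG : ∀ u, IsDistributionFunction (G u) := fun u => by
    by_cases hu : u ∈ Ioo (0 : ℝ) 1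
    · rw [hGF u hu]; exact hF.distribution u hu
    · rw [hG_def]; simp only [if_neg hu]; exact hF.distribution _ (by norm_num)
  have hm : ∀ y, Measurable (G · y) := fun y => by
    convert! measurable_ite_mem_Ioo_of_antitoneOn (hF.rearrangement y).1 (F (1 / 2) y) using 2 with u
    simp only [hG_def]
    split_ifs <;> rfl
  obtain ⟨K, hKm, hK, hKG⟩ := exists_kernel_of_isDistributionFunction hG hm
  refine ⟨K, quantileExt G, hKm, measurable_quantileExt hG hm, fun u hu t ht => ?_, hK,
    fun y => ?_⟩
  · rw [quantileExt_of_mem _ _ ht, hGF u hu, rearrangedQuantile]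
  · simp only [hKG]
    have := Measure.isProbabilityMeasure_map (μ := P) hX.aemeasurable
    have := Measure.isProbabilityMeasure_map (μ := unif) (hm y).aemeasurable
    refine Measure.ext_of_Ici _ _ fun w => ?_
    rw [Measure.map_apply (hm y) measurableSet_Ici,
      Measure.map_apply (measurable_kernel_real _ measurableSet_Iic) measurableSet_Ici,
      Measure.restrict_apply' measurableSet_Ioo]
    refine Eq.trans ?_ (((hF.rearrangement y).2 w).trans (volume_condDistrib_mvQuantile Y hX y w))
    congr 1
    ext u
    simp only [mem_inter_iff, mem_preimage, mem_Ici, mem_ofPred_eq, and_comm (a := u ∈ Ioo 0 1)]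
    exact and_congr_left fun hu => by rw [hGF u hu]

/-- A pair with conditional law `K`, obtained by transforming independent uniform variables. -/
lemma map_quantile_pair {U V : Ω → ℝ} (hU : Measurable U) (hV : Measurable V)
    (hUunif : P.map U = unif) (hVunif : P.map V = unif) (hUV : IndepFun U V P)
    {K : Kernel ℝ ℝ} [IsMarkovKernel K] {q : ℝ × ℝ → ℝ} (hq : Measurable q)
    (hK : ∀ u, unif.map (fun t => q (u, t)) = K u) :
    P.map (fun ω => (U ω, q (U ω, V ω))) = P.map U ⊗ₘ K := by
  rw [hUunif, ← map_prod_unif_eq_compProd unif K hq hK]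
  nth_rw 1 [← hUunif]
  rw [← hVunif, ← hUV.map_prod_eq_prod_map_map hU.aemeasurable hV.aemeasurable,
    Measure.map_map (measurable_fst.prodMk hq) (hU.prodMk hV)]
  rfl

lemma genInv_le_genInv {G G' : ℝ → ℝ} (hG : IsDistributionFunction G)
    (hG' : IsDistributionFunction G') (h : ∀ y, G' y ≤ G y) {t : ℝ} (ht : t ∈ Ioo (0 : ℝ) 1) :
    genInv G t ≤ genInv G' t :=
  (hG.genInv_le_iff ht _).2 (((hG'.genInv_le_iff ht _).1 le_rfl).trans (h _))

/-- Replaces the abstract conditional expectation by any a.e. version `κ` of the conditional law. -/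
lemma integral_comp_condSurvival {E : Type*} [MeasurableSpace E] {Y : Ω → ℝ} {X : Ω → E}
    (hY : Measurable Y) (hX : Measurable X) {κ : Kernel E ℝ}
    (hκ : condDistrib Y X P =ᵐ[P.map X] κ) {φ : ℝ → ℝ} (hφ : Continuous φ) (c : ℝ) :
    ∫ ω, φ (condSurvival P Y X c ω) ∂P = ∫ x, φ ((κ x).real (Ici c)) ∂P.map X := by
  have hm : Measurable fun x => φ ((κ x).real (Ici c)) :=
    hφ.measurable.comp (measurable_kernel_real κ measurableSet_Ici)
  rw [integral_map hX.aemeasurable hm.aestronglyMeasurable]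
  refine integral_congr_ae ?_
  filter_upwards [condDistrib_ae_eq_condExp (μ := P) hX hY (measurableSet_Ici (a := c)),
    ae_of_ae_map hX.aemeasurable hκ] with ω h1 h2
  rw [condSurvival, ← h1, h2]

end Coupling

/-! ### The three properties of the rearranged quantile transform. -/

section Main

variable {Ω Ω' : Type*} [MeasurableSpace Ω] [MeasurableSpace Ω'] {P : Measure Ω}
  [IsProbabilityMeasure P] {P' : Measure Ω'} [IsProbabilityMeasure P'] {p : ℕ} {Y : Ω → ℝ}
  {X : Ω → Fin p → ℝ} {U V : Ω' → ℝ} {F : ℝ → ℝ → ℝ}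

/-- Both conditional laws are images of the same noise `r` under `q (s, ·)` and `q (t, ·)`, which
are ordered a.e. The exceptional set concerns only where `condDistrib` equals `K`, so it does not
depend on `f`. -/
lemma isStochIncreasing_rearrangedQuantile {W : Ω' → ℝ} (hW : AEMeasurable W P')
    (hU : Measurable U) (hUunif : P'.map U = unif) (hF : IsRearrangedCDF P Y X F)
    {K : Kernel ℝ ℝ} {q : ℝ × ℝ → ℝ} (hq : Measurable q)
    (hqF : ∀ u ∈ Ioo (0 : ℝ) 1, ∀ t ∈ Ioo (0 : ℝ) 1, q (u, t) = rearrangedQuantile F u t)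
    (hK : ∀ u, unif.map (fun t => q (u, t)) = K u)
    (hcond : condDistrib W U P' =ᵐ[P'.map U] K) :
    IsStochIncreasing P' W U := by
  refine ⟨hW, hU.aemeasurable, {u | u ∈ Ioo (0 : ℝ) 1 ∧ condDistrib W U P' u = K u}, ?_, ?_⟩
  · have := ae_unif_mem
    rw [← hUunif] at this
    filter_upwards [this, hcond] with u h1 h2 using ⟨h1, h2⟩
  · rintro f hf s ⟨hs, hsK⟩ t ⟨ht, htK⟩ hst hfs hft
    have hqs : ∀ u, AEMeasurable (fun t => q (u, t)) unif := fun u =>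
      (hq.comp measurable_prodMk_left).aemeasurable
    have hfm : ∀ μ : Measure ℝ, AEStronglyMeasurable f μ := fun μ =>
      hf.measurable.aestronglyMeasurable
    rw [hsK, ← hK] at hfs ⊢
    rw [htK, ← hK] at hft ⊢
    rw [integral_map (hqs s) (hfm _), integral_map (hqs t) (hfm _)]
    refine integral_mono_ae ((integrable_map_measure (hfm _) (hqs s)).1 hfs)
      ((integrable_map_measure (hfm _) (hqs t)).1 hft) ?_
    filter_upwards [ae_unif_mem] with r hr
    refine hf ?_
    rw [hqF s hs r hr, hqF t ht r hr]
    exact genInv_le_genInv (hF.distribution s hs) (hF.distribution t ht)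
      (fun y => (hF.rearrangement y).1 hs ht hst) hr

theorem rearrangedQuantile_properties (hY : Measurable Y) (hX : Measurable X)
    (hU : Measurable U) (hV : Measurable V) (hUunif : P'.map U = unif)
    (hVunif : P'.map V = unif) (hUV : IndepFun U V P') (hF : IsRearrangedCDF P Y X F) :
    IdentDistrib (fun ω => rearrangedQuantile F (U ω) (V ω)) Y P' P ∧
      IsStochIncreasing P' (fun ω => rearrangedQuantile F (U ω) (V ω)) U ∧
      CcxEquiv P' (fun ω => rearrangedQuantile F (U ω) (V ω)) U P Y X := by
  obtain ⟨K, q, hKm, hq, hqF, hK, hlaw⟩ := hF.exists_kernel hX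
  set W : Ω' → ℝ := fun ω => rearrangedQuantile F (U ω) (V ω)
  set W' : Ω' → ℝ := fun ω => q (U ω, V ω) with hW'_def
  have hW' : Measurable W' := hq.comp (hU.prodMk hV)
  -- `W` need not be measurable, since `F` is arbitrary off `(0,1)`; `W'` is a measurable
  -- modification.
  have hWW' : W =ᵐ[P'] W' := by
    have hmemU := ae_unif_mem
    have hmemV := ae_unif_mem
    rw [← hUunif] at hmemU
    rw [← hVunif] at hmemV
    filter_upwards [ae_of_ae_map hU.aemeasurable hmemU,
      ae_of_ae_map hV.aemeasurable hmemV] with ω h1 h2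
    exact (hqF _ h1 _ h2).symm
  have hW : AEMeasurable W P' := hW'.aemeasurable.congr hWW'.symm
  have hcond : condDistrib W' U P' =ᵐ[P'.map U] K :=
    condDistrib_ae_eq_of_measure_eq_compProd U hW'.aemeasurable
      (map_quantile_pair hU hV hUunif hVunif hUV hq hK)
  have hmap : P'.map W = P.map Y := by
    rw [Measure.map_congr hWW', ← condDistrib_comp_map hU.aemeasurable hW'.aemeasurable,
      Measure.bind_congr_right hcond, hUunif,
      ← condDistrib_comp_map hX.aemeasurable hY.aemeasurable]
    exact comp_eq_of_map_Iic_eq hlaw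
  -- Equality at every common threshold `c`; convexity of `φ` enters only through continuity.
  have hsurv : ∀ (φ : ℝ → ℝ), ConvexOn ℝ univ φ → ∀ c,
      ∫ ω, φ (condSurvival P' W U c ω) ∂P' = ∫ ω, φ (condSurvival P Y X c ω) ∂P := by
    intro φ hφ c
    have hφc : Continuous φ := continuousOn_univ.1 (hφ.continuousOn isOpen_univ)
    rw [integral_comp_condSurvival hY hX (EventuallyEq.refl _ _) hφc,
      ← integral_comp_survival_eq hlaw hφc, ← hUunif,
      ← integral_comp_condSurvival hW' hU hcond hφc]
    refine integral_congr_ae ?_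
    filter_upwards [condSurvival_congr_ae U hWW' c] with ω hω
    rw [hω]
  have hquant : ∀ v, quantile P' W v = quantile P Y v := fun v => by
    rw [quantile, quantile, hmap]
  refine ⟨⟨hW, hY.aemeasurable, hmap⟩, ?_, fun v _ φ hφ => ?_, fun v _ φ hφ => ?_⟩
  · refine isStochIncreasing_rearrangedQuantile hW hU hUunif hF hq hqF hK ?_
    rwa [condDistrib_congr_left hWW']
  · rw [hquant, hsurv φ hφ]
  · rw [hquant, hsurv φ hφ]

end Main

end CondConvexOrder

theorem proposition8 {Ω Ω' : Type*} [MeasurableSpace Ω] [MeasurableSpace Ω']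
    (P : Measure Ω) [IsProbabilityMeasure P] (P' : Measure Ω') [IsProbabilityMeasure P']
    (p : ℕ) (Y : Ω → ℝ) (X : Ω → Fin p → ℝ) (hY : Measurable Y) (hX : Measurable X)
    (U V : Ω' → ℝ) (hU : Measurable U) (hV : Measurable V)
    (hUunif : P'.map U = volume.restrict (Ioo (0 : ℝ) 1))
    (hVunif : P'.map V = volume.restrict (Ioo (0 : ℝ) 1))
    (hUV : IndepFun U V P') :
    (∃ F : ℝ → ℝ → ℝ, IsRearrangedCDF P Y X F) ∧
      ∀ F : ℝ → ℝ → ℝ, IsRearrangedCDF P Y X F →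
        IdentDistrib (fun ω => rearrangedQuantile F (U ω) (V ω)) Y P' P ∧
        IsStochIncreasing P' (fun ω => rearrangedQuantile F (U ω) (V ω)) U ∧
        CcxEquiv P' (fun ω => rearrangedQuantile F (U ω) (V ω)) U P Y X := by
  have hW := fun F (hF : IsRearrangedCDF P Y X F) =>
    rearrangedQuantile_properties hY hX hU hV hUunif hVunif hUV hF
  exact ⟨exists_isRearrangedCDF Y hX, hW⟩
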